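/- Let $\mathfrak g=\mathfrak g_{\bar 0}\oplus\mathfrak g_{\bar 1}$ be a Lie superalgebra over $\mathbb C$ with universal enveloping algebra $U(\mathfrak g)$, and let $\theta$ be an involution of $\mathfrak g$, that is, an even (parity-preserving) automorphism with $\theta^2=\mathrm{id}$. Let $\mathfrak k$ and $\mathfrak p$ be the $+1$ and $-1$ eigenspaces of $\theta$, so that $\mathfrak g=\mathfrak k\oplus\mathfrak p$. Assume that $\mathfrak h\subseteq\mathfrak g_{\bar 0}$ is a subalgebra such that, with $\mathfrak a:=\mathfrak h\cap\mathfrak p$: (i) $\theta(\mathfrak h)=\mathfrak h$; (ii) the operators $\mathrm{ad}_x$, $x\in\mathfrak h$, are simultaneously diagonalizable on $\mathfrak g$; (iii) $\{x\in\mathfrak g: [x,y]=0\ \forall y\in\mathfrak h\}=\mathfrak h$ and $\{x\in\mathfrak p: [x,y]=0\ \forall y\in\mathfrak a\}=\mathfrak a$. Put $\mathcal I_L:=U(\mathfrak g)\mathfrak k$ and $\mathcal I:=\mathfrak kU(\mathfrak g)+U(\mathfrak g)\mathfrak k$. For a superspace $V$ let $S(V)$ be its supersymmetric algebra, i.e.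 the quotient of the tensor algebra by the relations $xy=(-1)^{|x||y|}yx$ for homogeneous $x,y\in V$. Let $\mathsf s:S(\mathfrak p)\to U(\mathfrak g)$ be the supersymmetrization map: for homogeneous $x_1,\dots,x_r\in\mathfrak p$, \[ \mathsf s(x_1\cdots x_r)=\frac1{r!}\sum_{\pi\in S_r}\mathrm{sgn}(\pi;x)\,x_{\pi(1)}\cdots x_{\pi(r)}, \] where $\mathrm{sgn}(\pi;x)$ is the sign of the permutation induced by $\pi$ on the odd vectors among $x_1,\dots,x_r$. Let $\bar{\mathsf s}:S(\mathfrak p)\to U(\mathfrak g)/\mathcal I_L$ be the map induced by $\mathsf s$ and let $\mathsf q:U(\mathfrak g)/\mathcal I_L\to U(\mathfrak g)/\mathcal I$ be the quotient map. Regard $S(\mathfrak a)\subseteq S(\mathfrak p)$. Then \[ U(\mathfrak g)=\mathcal I+\mathsf s(S(\mathfrak a)). \] In particular, the restriction of $\mathsf q\circ\bar{\mathsf s}$ to $S(\mathfrak a)$ is a surjective map $S(\mathfrak a)\to U(\mathfrak g)/\mathcal I$. -/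

import Mathlib

noncomputable section

/-- The sign `(-1)^{ij}` for parities `i j : ZMod 2`. -/
def koszulSign (i j : ZMod 2) : ℂ := if i = 1 ∧ j = 1 then -1 else 1

theorem koszulSign_comm (i j : ZMod 2) : koszulSign i j = koszulSign j i := by
  simp only [koszulSign, and_comm]

theorem koszulSign_mul_self (i j : ZMod 2) : koszulSign i j * koszulSign i j = 1 := by
  unfold koszulSign; split_ifs <;> norm_num

/-! ### The supersymmetric algebra of a superspace -/

section SuperSym

variable {V W A : Type*} [AddCommGroup V] [Module ℂ V] [AddCommGroup W] [Module ℂ W]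
  [Ring A] [Algebra ℂ A]

/-- The supercommutation relations `x y = (-1)^{|x||y|} y x` for homogeneous `x`, `y`. -/
inductive SuperSymRel (𝒱 : ZMod 2 → Submodule ℂ V) :
    TensorAlgebra ℂ V → TensorAlgebra ℂ V → Prop
  | comm {i j : ZMod 2} {x y : V} (hx : x ∈ 𝒱 i) (hy : y ∈ 𝒱 j) :
      SuperSymRel 𝒱 (TensorAlgebra.ι ℂ x * TensorAlgebra.ι ℂ y)
        (koszulSign i j • (TensorAlgebra.ι ℂ y * TensorAlgebra.ι ℂ x))

/-- The supersymmetric algebra `S(V)` of a superspace `V`, the `ZMod 2`-grading of `V` being `𝒱`. -/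
abbrev SuperSymAlg (𝒱 : ZMod 2 → Submodule ℂ V) : Type _ := RingQuot (SuperSymRel 𝒱)

/-- The canonical map `V → S(V)`. -/
def SuperSymAlg.ι (𝒱 : ZMod 2 → Submodule ℂ V) : V →ₗ[ℂ] SuperSymAlg 𝒱 :=
  (RingQuot.mkAlgHom ℂ (SuperSymRel 𝒱)).toLinearMap ∘ₗ TensorAlgebra.ι ℂ

theorem SuperSymAlg.ι_mul_ι (𝒱 : ZMod 2 → Submodule ℂ V) {i j : ZMod 2} {x y : V}
    (hx : x ∈ 𝒱 i) (hy : y ∈ 𝒱 j) :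
    SuperSymAlg.ι 𝒱 x * SuperSymAlg.ι 𝒱 y =
      koszulSign i j • (SuperSymAlg.ι 𝒱 y * SuperSymAlg.ι 𝒱 x) := by
  simpa [SuperSymAlg.ι] using RingQuot.mkAlgHom_rel ℂ (SuperSymRel.comm (𝒱 := 𝒱) hx hy)

/-- The algebra homomorphism `S(V) → S(W)` induced by an even linear map `V → W`. -/
def SuperSymAlg.map {𝒱 : ZMod 2 → Submodule ℂ V} {𝒲 : ZMod 2 → Submodule ℂ W} (f : V →ₗ[ℂ] W)
    (hf : ∀ i, ∀ x ∈ 𝒱 i, f x ∈ 𝒲 i) : SuperSymAlg 𝒱 →ₐ[ℂ] SuperSymAlg 𝒲 :=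
  RingQuot.liftAlgHom ℂ ⟨TensorAlgebra.lift ℂ (SuperSymAlg.ι 𝒲 ∘ₗ f), by
    rintro _ _ ⟨hx, hy⟩
    simpa using SuperSymAlg.ι_mul_ι 𝒲 (hf _ _ hx) (hf _ _ hy)⟩

theorem SuperSymAlg.map_ι {𝒱 : ZMod 2 → Submodule ℂ V} {𝒲 : ZMod 2 → Submodule ℂ W}
    (f : V →ₗ[ℂ] W) (hf : ∀ i, ∀ x ∈ 𝒱 i, f x ∈ 𝒲 i) (x : V) :
    SuperSymAlg.map f hf (SuperSymAlg.ι 𝒱 x) = SuperSymAlg.ι 𝒲 (f x) := by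
  simp [SuperSymAlg.map, SuperSymAlg.ι]

/-- For vectors `x_1, …, x_n` of parities `ε_1, …, ε_n`, the sign `sgn(π; x)` of the permutation
induced by `π` on the odd vectors among them: a factor `-1` for each inversion of
`x_{π(1)}, …, x_{π(n)}` which involves two odd vectors. -/
def superSign {n : ℕ} (ε : Fin n → ZMod 2) (π : Equiv.Perm (Fin n)) : ℂ :=
  ∏ p : Fin n × Fin n with p.1 < p.2 ∧ π p.2 < π p.1, koszulSign (ε (π p.1)) (ε (π p.2))

theorem prod_pairs_perm {n : ℕ} (g : Fin n → Fin n → ℂ) (hg : ∀ i j, i ≠ j → g i j = g j i)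
    (π : Equiv.Perm (Fin n)) :
    ∏ p : Fin n × Fin n with p.1 < p.2, g (π p.1) (π p.2) =
      ∏ p : Fin n × Fin n with p.1 < p.2, g p.1 p.2 := by
  have hne : ∀ i j : Fin n, i < j → π i ≠ π j := fun i j h e => h.ne (π.injective e)
  refine Finset.prod_bij'
    (fun p _ => if π p.1 < π p.2 then (π p.1, π p.2) else (π p.2, π p.1))
    (fun p _ => if π.symm p.1 < π.symm p.2 then (π.symm p.1, π.symm p.2)
      else (π.symm p.2, π.symm p.1)) ?_ ?_ ?_ ?_ ?_
  · rintro ⟨i, j⟩ h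
    simp only [Finset.mem_filter, Finset.mem_univ, true_and] at h ⊢
    split_ifs with h1
    · exact h1
    · exact lt_of_le_of_ne (not_lt.1 h1) (hne i j h).symm
  · rintro ⟨i, j⟩ h
    simp only [Finset.mem_filter, Finset.mem_univ, true_and] at h ⊢
    split_ifs with h1
    · exact h1
    · exact lt_of_le_of_ne (not_lt.1 h1) (fun e => h.ne (π.symm.injective e).symm)
  · rintro ⟨i, j⟩ h
    simp only [Finset.mem_filter, Finset.mem_univ, true_and] at h
    by_cases h1 : π i < π j
    · simp [h1, h]
    · simp [h1, h.not_gt]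
  · rintro ⟨i, j⟩ h
    simp only [Finset.mem_filter, Finset.mem_univ, true_and] at h
    by_cases h1 : π.symm i < π.symm j
    · simp [h1, h]
    · simp [h1, h.not_gt]
  · rintro ⟨i, j⟩ h
    simp only [Finset.mem_filter, Finset.mem_univ, true_and] at h
    split_ifs with h1
    · rfl
    · exact hg _ _ (hne i j h)

theorem superSign_eq {n : ℕ} (ε : Fin n → ZMod 2) (π : Equiv.Perm (Fin n)) :
    superSign ε π = ∏ p : Fin n × Fin n with p.1 < p.2,
      if π p.2 < π p.1 then koszulSign (ε (π p.1)) (ε (π p.2)) else 1 := by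
  rw [superSign, ← Finset.filter_filter, Finset.prod_filter]

theorem superSign_mul_self {n : ℕ} (ε : Fin n → ZMod 2) (π : Equiv.Perm (Fin n)) :
    superSign ε π * superSign ε π = 1 := by
  rw [superSign, ← Finset.prod_mul_distrib]
  exact Finset.prod_eq_one fun p _ => koszulSign_mul_self _ _

theorem superSign_mul {n : ℕ} (ε : Fin n → ZMod 2) (τ π : Equiv.Perm (Fin n)) :
    superSign ε (τ * π) = superSign ε τ * superSign (ε ∘ τ) π := by
  let σ : Fin n → Fin n → ℂ := fun a b =>
    if τ b < τ a then koszulSign (ε (τ a)) (ε (τ b)) else 1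
  let σ' : Fin n → Fin n → ℂ := fun a b =>
    if b < a then koszulSign (ε (τ a)) (ε (τ b)) else 1
  have key := prod_pairs_perm (fun a b => σ a b * σ' a b) (fun a b hab => by
    have hτ : τ a ≠ τ b := fun e => hab (τ.injective e)
    have hc := koszulSign_comm (ε (τ a)) (ε (τ b))
    have hs := koszulSign_mul_self (ε (τ b)) (ε (τ a))
    simp only [σ, σ']
    rcases lt_or_gt_of_ne hab with h1 | h1 <;> rcases lt_or_gt_of_ne hτ with h2 | h2 <;>
      simp [h1, h2, h1.not_gt, h2.not_gt, hc, hs]) π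
  rw [Finset.prod_mul_distrib, Finset.prod_mul_distrib] at key
  have e1 : superSign ε (τ * π) = ∏ p : Fin n × Fin n with p.1 < p.2, σ (π p.1) (π p.2) := by
    rw [superSign_eq]; rfl
  have e2 : superSign (ε ∘ τ) π = ∏ p : Fin n × Fin n with p.1 < p.2, σ' (π p.1) (π p.2) := by
    rw [superSign_eq]; rfl
  have e3 : superSign ε τ = ∏ p : Fin n × Fin n with p.1 < p.2, σ p.1 p.2 := by
    rw [superSign_eq]
  have e4 : ∏ p : Fin n × Fin n with p.1 < p.2, σ' p.1 p.2 = 1 := by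
    refine Finset.prod_eq_one fun p hp => ?_
    simp only [Finset.mem_filter, Finset.mem_univ, true_and] at hp
    simp [σ', hp.not_gt]
  rw [← e1, ← e2, ← e3, e4, mul_one] at key
  rw [← key, mul_assoc, superSign_mul_self, mul_one]

theorem superSign_swap {n : ℕ} (ε : Fin n → ZMod 2) (a b : Fin n) (hab : (a : ℕ) + 1 = b) :
    superSign ε (Equiv.swap a b) = koszulSign (ε a) (ε b) := by
  have hlt : a < b := by rw [Fin.lt_def]; omega
  have : (Finset.univ.filter fun p : Fin n × Fin n =>
      p.1 < p.2 ∧ Equiv.swap a b p.2 < Equiv.swap a b p.1) = {(a, b)} := by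
    ext ⟨i, j⟩
    rw [Finset.mem_filter, Finset.mem_singleton, Prod.mk.injEq]
    simp only [Finset.mem_univ, true_and]
    constructor
    · rintro ⟨h1, h2⟩
      rw [Equiv.swap_apply_def, Equiv.swap_apply_def] at h2
      split_ifs at h2 <;> simp only [Fin.lt_def, Fin.ext_iff] at * <;> omega
    · rintro ⟨rfl, rfl⟩
      simp [hlt]
  rw [superSign, this, Finset.prod_singleton]
  simp [koszulSign_comm]

variable (𝒱 : ZMod 2 → Submodule ℂ V) [DirectSum.Decomposition 𝒱]

/-- The projection of `V` onto its homogeneous component of parity `i`. -/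
def superProj (i : ZMod 2) : V →ₗ[ℂ] V :=
  (𝒱 i).subtype ∘ₗ DirectSum.component ℂ (ZMod 2) (fun i => 𝒱 i) i ∘ₗ
    (DirectSum.decomposeLinearEquiv 𝒱).toLinearMap

theorem superProj_of_mem {i : ZMod 2} {x : V} (hx : x ∈ 𝒱 i) (j : ZMod 2) :
    superProj 𝒱 j x = if i = j then x else 0 := by
  have : superProj 𝒱 j x = (DirectSum.decompose 𝒱 x j : V) := rfl
  rw [this]
  split_ifs with h
  · subst h; exact DirectSum.decompose_of_mem_same 𝒱 hx
  · exact DirectSum.decompose_of_mem_ne 𝒱 hx h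

/-- The multilinear map which sends homogeneous vectors `x_1, …, x_n` to
`(1/n!) ∑_π sgn(π; x) f(x_{π(1)}) ⋯ f(x_{π(n)})`. The sum over `ε` is over all the ways to pick
parities for the homogeneous components of the arguments. -/
def supersymMultilinear (f : V →ₗ[ℂ] A) (n : ℕ) : MultilinearMap ℂ (fun _ : Fin n => V) A :=
  (n.factorial : ℂ)⁻¹ • ∑ ε : Fin n → ZMod 2, ∑ π : Equiv.Perm (Fin n), superSign ε π •
    ((MultilinearMap.mkPiAlgebraFin ℂ n A).compLinearMap
      fun i => f ∘ₗ superProj 𝒱 (ε (π i))).domDomCongr π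

theorem supersymMultilinear_apply (f : V →ₗ[ℂ] A) {n : ℕ} (x : Fin n → V) (ε : Fin n → ZMod 2)
    (hx : ∀ i, x i ∈ 𝒱 (ε i)) :
    supersymMultilinear 𝒱 f n x = (n.factorial : ℂ)⁻¹ • ∑ π : Equiv.Perm (Fin n),
      superSign ε π • (List.ofFn fun i => f (x (π i))).prod := by
  simp only [supersymMultilinear, smul_apply, sum_apply,
    MultilinearMap.domDomCongr_apply, MultilinearMap.compLinearMap_apply]
  congr 1
  rw [Finset.sum_eq_single ε]
  · refine Finset.sum_congr rfl fun π _ => ?_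
    simp [superProj_of_mem 𝒱 (hx _)]
  · intro ε' _ hne
    refine Finset.sum_eq_zero fun π _ => ?_
    obtain ⟨j, hj⟩ := Function.ne_iff.1 hne
    rw [MultilinearMap.map_coord_zero (i := π.symm j), smul_zero]
    simp [superProj_of_mem 𝒱 (hx _), hj.symm]
  · simp

theorem supersymMultilinear_perm (f : V →ₗ[ℂ] A) {n : ℕ} (x : Fin n → V) (ε : Fin n → ZMod 2)
    (hx : ∀ i, x i ∈ 𝒱 (ε i)) (τ : Equiv.Perm (Fin n)) :
    supersymMultilinear 𝒱 f n x = superSign ε τ • supersymMultilinear 𝒱 f n (x ∘ τ) := by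
  rw [supersymMultilinear_apply 𝒱 f x ε hx,
    supersymMultilinear_apply 𝒱 f (x ∘ τ) (ε ∘ τ) (fun i => hx (τ i)), smul_comm]
  congr 1
  rw [Finset.smul_sum, ← Equiv.sum_comp (Equiv.mulLeft τ)]
  refine Finset.sum_congr rfl fun π _ => ?_
  rw [smul_smul, Equiv.coe_mulLeft, superSign_mul]
  rfl

/-- The supersymmetrization on the level of the tensor algebra. -/
def supersymTensor (f : V →ₗ[ℂ] A) : TensorAlgebra ℂ V →ₗ[ℂ] A :=
  DirectSum.toModule ℂ ℕ A (fun n => PiTensorProduct.lift (supersymMultilinear 𝒱 f n)) ∘ₗ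
    TensorAlgebra.equivDirectSum.toLinearMap

theorem supersymTensor_prod (f : V →ₗ[ℂ] A) {n : ℕ} (x : Fin n → V) :
    supersymTensor 𝒱 f (List.ofFn fun i => TensorAlgebra.ι ℂ (x i)).prod =
      supersymMultilinear 𝒱 f n x := by
  have h := TensorAlgebra.toDirectSum_tensorPower_tprod (R := ℂ) x
  rw [TensorAlgebra.tprod_apply] at h
  have h' : supersymTensor 𝒱 f (List.ofFn fun i => TensorAlgebra.ι ℂ (x i)).prod =
      DirectSum.toModule ℂ ℕ A (fun n => PiTensorProduct.lift (supersymMultilinear 𝒱 f n))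
        (TensorAlgebra.toDirectSum (List.ofFn fun i => TensorAlgebra.ι ℂ (x i)).prod) := rfl
  rw [h', h, ← DirectSum.lof_eq_of ℂ, DirectSum.toModule_lof, PiTensorProduct.lift.tprod]

theorem supersymTensor_rel_list (f : V →ₗ[ℂ] A) (L₁ L₂ : List (Σ i, 𝒱 i)) (p q : Σ i, 𝒱 i) :
    supersymTensor 𝒱 f ((L₁ ++ p :: q :: L₂).map fun r => TensorAlgebra.ι ℂ (r.2 : V)).prod =
      koszulSign p.1 q.1 • supersymTensor 𝒱 f
        ((L₁ ++ q :: p :: L₂).map fun r => TensorAlgebra.ι ℂ (r.2 : V)).prod := by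
  set L := L₁ ++ p :: q :: L₂ with hL
  set L' := L₁ ++ q :: p :: L₂ with hL'
  have hlen : L'.length = L.length := by simp [hL, hL']
  have hk : L₁.length < L.length := by simp [hL]
  have hk1 : L₁.length + 1 < L.length := by simp [hL]
  let z : Fin L.length → Σ i, 𝒱 i := fun i => L[i]
  let a : Fin L.length := ⟨L₁.length, hk⟩
  let b : Fin L.length := ⟨L₁.length + 1, hk1⟩
  have h1 : L = List.ofFn z := (List.ofFn_getElem (xs := L)).symm
  have h2 : L' = List.ofFn (z ∘ Equiv.swap a b) := by
    apply List.ext_getElem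
    · simp [hlen]
    · intro i hi hi'
      rw [List.getElem_ofFn]
      simp only [Function.comp, z, Equiv.swap_apply_def, Fin.ext_iff, a, b, hL', hL]
      by_cases c1 : i = L₁.length
      · subst c1; simp
      · by_cases c2 : i = L₁.length + 1
        · subst c2; simp
        · simp only [c1, c2, if_false]
          rcases lt_or_gt_of_ne c1 with c | c
          · simp [List.getElem_append_left c]
          · obtain ⟨m, rfl⟩ : ∃ m, i = L₁.length + (m + 2) := ⟨i - L₁.length - 2, by omega⟩
            simp
  have hz : ∀ i, ((z i).2 : V) ∈ 𝒱 (z i).1 := fun i => (z i).2.2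
  have hp := supersymMultilinear_perm 𝒱 f (fun i => ((z i).2 : V)) (fun i => (z i).1) hz
    (Equiv.swap a b)
  rw [superSign_swap _ a b rfl] at hp
  have ha : z a = p := by simp [z, a, hL]
  have hb : z b = q := by simp [z, b, hL]
  rw [ha, hb, ← supersymTensor_prod, ← supersymTensor_prod] at hp
  have h1' : L.map (fun r => TensorAlgebra.ι ℂ (r.2 : V)) =
      List.ofFn fun i => TensorAlgebra.ι ℂ ((z i).2 : V) := by
    conv_lhs => rw [h1, List.map_ofFn]
    rfl
  rw [h2, h1', List.map_ofFn]
  exact hp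

theorem span_homogeneous_products : Submodule.span ℂ (Set.range fun L : List (Σ i, 𝒱 i) =>
    (L.map fun r => TensorAlgebra.ι ℂ (r.2 : V)).prod) = ⊤ := by
  let s : Set (TensorAlgebra ℂ V) := Set.range fun r : Σ i, 𝒱 i => TensorAlgebra.ι ℂ (r.2 : V)
  have h1 : Algebra.adjoin ℂ s = ⊤ := by
    rw [← top_le_iff, ← TensorAlgebra.adjoin_range_ι, Algebra.adjoin_le_iff]
    rintro _ ⟨x, rfl⟩
    induction x using DirectSum.Decomposition.inductionOn 𝒱 with
    | zero => rw [map_zero]; exact zero_mem _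
    | homogeneous m => exact Algebra.subset_adjoin ⟨⟨_, m⟩, rfl⟩
    | add m m' hm hm' => rw [map_add]; exact add_mem hm hm'
  rw [← top_le_iff, ← Algebra.top_toSubmodule, ← h1, Algebra.adjoin_eq_span]
  refine Submodule.span_mono fun x hx => ?_
  obtain ⟨l, hl, rfl⟩ := Submonoid.exists_list_of_mem_closure hx
  choose! g hg using hl
  refine ⟨l.map g, ?_⟩
  simp only [List.map_map]
  congr 1
  conv_rhs => rw [← List.map_id l]
  exact List.map_congr_left fun y hy => hg y hy

theorem supersymTensor_rel (f : V →ₗ[ℂ] A) {x y : TensorAlgebra ℂ V} (h : SuperSymRel 𝒱 x y)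
    (u v : TensorAlgebra ℂ V) :
    supersymTensor 𝒱 f (u * x * v) = supersymTensor 𝒱 f (u * y * v) := by
  obtain ⟨hx, hy⟩ := h
  rename_i i j x y
  have hu : u ∈ Submodule.span ℂ (Set.range fun L : List (Σ i, 𝒱 i) =>
    (L.map fun r => TensorAlgebra.ι ℂ (r.2 : V)).prod) := by
      rw [span_homogeneous_products]; trivial
  have hv : v ∈ Submodule.span ℂ (Set.range fun L : List (Σ i, 𝒱 i) =>
    (L.map fun r => TensorAlgebra.ι ℂ (r.2 : V)).prod) := by
      rw [span_homogeneous_products]; trivial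
  induction hu using Submodule.span_induction with
  | zero => simp
  | add a b _ _ ha hb => simp only [add_mul, map_add, ha, hb]
  | smul c a _ ha => simp only [smul_mul_assoc, map_smul] at ha ⊢; rw [ha]
  | mem u hu =>
    induction hv using Submodule.span_induction with
    | zero => simp
    | add a b _ _ ha hb => simp only [mul_add, map_add, ha, hb]
    | smul c a _ ha => simp only [mul_smul_comm, map_smul] at ha ⊢; rw [ha]
    | mem v hv =>
      obtain ⟨L₁, rfl⟩ := hu
      obtain ⟨L₂, rfl⟩ := hv
      have := supersymTensor_rel_list 𝒱 f L₁ L₂ ⟨i, x, hx⟩ ⟨j, y, hy⟩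
      simpa [mul_assoc] using this

theorem supersymTensor_ker (f : V →ₗ[ℂ] A) :
    LinearMap.ker (RingQuot.mkAlgHom ℂ (SuperSymRel 𝒱)).toLinearMap ≤
      LinearMap.ker (supersymTensor 𝒱 f) := by
  intro x hx
  rw [LinearMap.mem_ker] at hx ⊢
  have h0 : RingQuot.mkRingHom (SuperSymRel 𝒱) x = RingQuot.mkRingHom (SuperSymRel 𝒱) 0 := by
    rw [map_zero, ← RingQuot.mkAlgHom_coe ℂ]; exact hx
  have h1 : Relation.EqvGen (RingQuot.Rel (SuperSymRel 𝒱)) x 0 := by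
    apply Quot.eqvGen_exact
    simpa [RingQuot.mkRingHom_def] using h0
  have key : ∀ a b : TensorAlgebra ℂ V, RingQuot.Rel (SuperSymRel 𝒱) a b → ∀ u v,
      supersymTensor 𝒱 f (u * a * v) = supersymTensor 𝒱 f (u * b * v) := by
    intro a b hab
    induction hab with
    | of h => exact supersymTensor_rel 𝒱 f h
    | add_left _ ih => intro u v; simp only [mul_add, add_mul, map_add, ih]
    | mul_left _ ih => intro u v; simpa [mul_assoc] using ih u (_ * v)
    | mul_right _ ih => intro u v; simpa [mul_assoc] using ih (u * _) v
  clear hx h0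
  rw [← map_zero (supersymTensor 𝒱 f)]
  generalize (0 : TensorAlgebra ℂ V) = y at h1
  induction h1 with
  | rel a b h => simpa using key a b h 1 1
  | refl => rfl
  | symm _ _ _ ih => exact ih.symm
  | trans _ _ _ _ _ ih1 ih2 => exact ih1.trans ih2

/-- The supersymmetrization `S(V) → A` attached to a linear map `f` from a superspace `V` to an
associative algebra `A`:
`x_1 ⋯ x_n ↦ (1/n!) ∑_π sgn(π; x) f(x_{π(1)}) ⋯ f(x_{π(n)})` for homogeneous `x_1, …, x_n`;
see `supersymmetrization_prod`. -/
def supersymmetrization (f : V →ₗ[ℂ] A) : SuperSymAlg 𝒱 →ₗ[ℂ] A :=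
  (LinearMap.ker (RingQuot.mkAlgHom ℂ (SuperSymRel 𝒱)).toLinearMap).liftQ
      (supersymTensor 𝒱 f) (supersymTensor_ker 𝒱 f) ∘ₗ
    ((RingQuot.mkAlgHom ℂ (SuperSymRel 𝒱)).toLinearMap.quotKerEquivOfSurjective
      (RingQuot.mkAlgHom_surjective ℂ (SuperSymRel 𝒱))).symm.toLinearMap

theorem supersymmetrization_mk (f : V →ₗ[ℂ] A) (x : TensorAlgebra ℂ V) :
    supersymmetrization 𝒱 f (RingQuot.mkAlgHom ℂ (SuperSymRel 𝒱) x) = supersymTensor 𝒱 f x := by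
  have : ((RingQuot.mkAlgHom ℂ (SuperSymRel 𝒱)).toLinearMap.quotKerEquivOfSurjective
      (RingQuot.mkAlgHom_surjective ℂ (SuperSymRel 𝒱))).symm
      (RingQuot.mkAlgHom ℂ (SuperSymRel 𝒱) x) = Submodule.Quotient.mk x := by
    rw [LinearEquiv.symm_apply_eq]; rfl
  simp only [supersymmetrization, LinearMap.comp_apply, LinearEquiv.coe_coe, this]
  exact Submodule.liftQ_apply _ _ _

theorem supersymmetrization_prod (f : V →ₗ[ℂ] A) {n : ℕ} (x : Fin n → V) (ε : Fin n → ZMod 2)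
    (hx : ∀ i, x i ∈ 𝒱 (ε i)) :
    supersymmetrization 𝒱 f (List.ofFn fun i => SuperSymAlg.ι 𝒱 (x i)).prod =
      (n.factorial : ℂ)⁻¹ • ∑ π : Equiv.Perm (Fin n),
        superSign ε π • (List.ofFn fun i => f (x (π i))).prod := by
  rw [← supersymMultilinear_apply 𝒱 f x ε hx, ← supersymTensor_prod, ← supersymmetrization_mk,
    map_list_prod (RingQuot.mkAlgHom ℂ (SuperSymRel 𝒱)), List.map_ofFn]
  rfl

end SuperSym

/-! ### Lie superalgebras and their enveloping algebras -/

/-- A complex Lie superalgebra. -/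
class LieSuperalgebra (𝔤 : Type*) [AddCommGroup 𝔤] [Module ℂ 𝔤] where
  /-- The even part is `grading 0` and the odd part is `grading 1`. -/
  grading : ZMod 2 → Submodule ℂ 𝔤
  isInternal : DirectSum.IsInternal grading
  /-- The superbracket. -/
  bracket : 𝔤 →ₗ[ℂ] 𝔤 →ₗ[ℂ] 𝔤
  bracket_mem : ∀ {i j : ZMod 2} {x y : 𝔤}, x ∈ grading i → y ∈ grading j →
    bracket x y ∈ grading (i + j)
  skew : ∀ {i j : ZMod 2} {x y : 𝔤}, x ∈ grading i → y ∈ grading j →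
    bracket x y = -(koszulSign i j • bracket y x)
  jacobi : ∀ {i j : ZMod 2} {x y : 𝔤} (z : 𝔤), x ∈ grading i → y ∈ grading j →
    bracket x (bracket y z) = bracket (bracket x y) z + koszulSign i j • bracket y (bracket x z)

namespace LieSuperalgebra

variable {𝔤 : Type*} [AddCommGroup 𝔤] [Module ℂ 𝔤] [LieSuperalgebra 𝔤]

instance instDecomposition : DirectSum.Decomposition (grading (𝔤 := 𝔤)) :=
  isInternal.chooseDecomposition

variable (𝔤) in
/-- The defining relations `x y = (-1)^{|x||y|} y x + [x, y]` (for homogeneous `x`, `y`) of the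
universal enveloping algebra. -/
inductive EnvRel : TensorAlgebra ℂ 𝔤 → TensorAlgebra ℂ 𝔤 → Prop
  | comm {i j : ZMod 2} {x y : 𝔤} (hx : x ∈ grading i) (hy : y ∈ grading j) :
      EnvRel (TensorAlgebra.ι ℂ x * TensorAlgebra.ι ℂ y)
        (koszulSign i j • (TensorAlgebra.ι ℂ y * TensorAlgebra.ι ℂ x) +
          TensorAlgebra.ι ℂ (bracket x y))

variable (𝔤) in
/-- The universal enveloping algebra `U(𝔤)`. -/
abbrev Env : Type _ := RingQuot (EnvRel 𝔤)

/-- The canonical map `𝔤 → U(𝔤)`. -/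
def envι : 𝔤 →ₗ[ℂ] Env 𝔤 := (RingQuot.mkAlgHom ℂ (EnvRel 𝔤)).toLinearMap ∘ₗ TensorAlgebra.ι ℂ

variable (𝔤) in
/-- An involution of a Lie superalgebra: an (even) automorphism whose square is the identity. -/
structure Involution where
  toLinearMap : 𝔤 →ₗ[ℂ] 𝔤
  map_mem : ∀ {i : ZMod 2} {x : 𝔤}, x ∈ grading i → toLinearMap x ∈ grading i
  map_bracket : ∀ x y, toLinearMap (bracket x y) = bracket (toLinearMap x) (toLinearMap y)
  involutive : ∀ x, toLinearMap (toLinearMap x) = x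

/-- The centralizer `C_𝔟(𝔞) = {x ∈ 𝔟 | [x, y] = 0 for all y ∈ 𝔞}`. -/
def centralizer (𝔟 𝔞 : Submodule ℂ 𝔤) : Submodule ℂ 𝔤 where
  carrier := {x | x ∈ 𝔟 ∧ ∀ y ∈ 𝔞, bracket x y = 0}
  zero_mem' := by simp
  add_mem' := by
    rintro x x' ⟨hx, h⟩ ⟨hx', h'⟩
    exact ⟨add_mem hx hx', fun y hy => by simp [h y hy, h' y hy]⟩
  smul_mem' := by
    rintro c x ⟨hx, h⟩
    exact ⟨Submodule.smul_mem _ c hx, fun y hy => by simp [h y hy]⟩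

/-- The operators `ad_x`, `x ∈ 𝔥`, are simultaneously diagonalizable on `𝔤`: the common
eigenvectors span `𝔤`. -/
def AdDiagonalizable (𝔥 : Submodule ℂ 𝔤) : Prop :=
  Submodule.span ℂ {v : 𝔤 | ∀ x ∈ 𝔥, ∃ c : ℂ, bracket x v = c • v} = ⊤

/-- The grading of a graded subspace of `𝔤`. -/
def subGrading (W : Submodule ℂ 𝔤) (i : ZMod 2) : Submodule ℂ W := (grading i).comap W.subtype

/-- The supersymmetric algebra `S(W)` of a graded subspace `W` of `𝔤`. -/
abbrev SymOf (W : Submodule ℂ 𝔤) : Type _ := SuperSymAlg (subGrading W)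

/-- The supersymmetrization map `𝗌 : S(W) → U(𝔤)` for a graded subspace `W` of `𝔤`, i.e. the
restriction to `S(W)` of the supersymmetrization map `S(𝔤) → U(𝔤)`. -/
def symmetrize (W : Submodule ℂ 𝔤) : SymOf W →ₗ[ℂ] Env 𝔤 :=
  supersymmetrization (grading (𝔤 := 𝔤)) envι ∘ₗ
    (SuperSymAlg.map (𝒱 := subGrading W) W.subtype fun _ _ hx => hx).toLinearMap

theorem symmetrize_prod (W : Submodule ℂ 𝔤) {n : ℕ} (x : Fin n → W) (ε : Fin n → ZMod 2)
    (hx : ∀ i, (x i : 𝔤) ∈ grading (ε i)) :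
    symmetrize W (List.ofFn fun i => SuperSymAlg.ι (subGrading W) (x i)).prod =
      (n.factorial : ℂ)⁻¹ • ∑ π : Equiv.Perm (Fin n),
        superSign ε π • (List.ofFn fun i => envι (x (π i) : 𝔤)).prod := by
  rw [← supersymmetrization_prod grading envι (fun i => (x i : 𝔤)) ε hx, symmetrize,
    LinearMap.comp_apply, AlgHom.toLinearMap_apply, map_list_prod, List.map_ofFn]
  congr 3
  funext i
  exact SuperSymAlg.map_ι W.subtype _ (x i)

/-- The map `S(W) → S(W')` induced by an inclusion `W ⊆ W'`. -/
def symInclusion {W W' : Submodule ℂ 𝔤} (h : W ≤ W') : SymOf W →ₐ[ℂ] SymOf W' :=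
  SuperSymAlg.map (Submodule.inclusion h) fun _ _ hx => hx

namespace Involution

variable (θ : Involution 𝔤)

/-- The fixed subalgebra `𝔨` of the involution. -/
def fixedPart : Submodule ℂ 𝔤 := Module.End.eigenspace θ.toLinearMap 1

/-- The `(-1)`-eigenspace `𝔭` of the involution. -/
def antiPart : Submodule ℂ 𝔤 := Module.End.eigenspace θ.toLinearMap (-1)

/-- `𝔞 = 𝔥 ∩ 𝔭`. -/
def splitPart (𝔥 : Submodule ℂ 𝔤) : Submodule ℂ 𝔤 := 𝔥 ⊓ θ.antiPart

theorem splitPart_le (𝔥 : Submodule ℂ 𝔤) : θ.splitPart 𝔥 ≤ θ.antiPart := inf_le_right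

/-- `I_L = U(𝔤)𝔨`, the span of the products `u k`. -/
def leftIdeal : Submodule ℂ (Env 𝔤) := ⊤ * θ.fixedPart.map envι

/-- `I = 𝔨U(𝔤) + U(𝔤)𝔨`. -/
def biIdeal : Submodule ℂ (Env 𝔤) := θ.fixedPart.map envι * ⊤ + ⊤ * θ.fixedPart.map envι

theorem leftIdeal_le_biIdeal : θ.leftIdeal ≤ θ.biIdeal := le_sup_right

/-- The map `𝗌̄ : S(𝔭) → U(𝔤)/I_L` induced by `𝗌`. -/
def sBar : SymOf θ.antiPart →ₗ[ℂ] Env 𝔤 ⧸ θ.leftIdeal :=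
  θ.leftIdeal.mkQ ∘ₗ symmetrize θ.antiPart

/-- The quotient map `𝗊 : U(𝔤)/I_L → U(𝔤)/I`. -/
def quotMap : (Env 𝔤 ⧸ θ.leftIdeal) →ₗ[ℂ] Env 𝔤 ⧸ θ.biIdeal :=
  Submodule.factor θ.leftIdeal_le_biIdeal

end Involution

end LieSuperalgebra

end

/-! Let `K`, `P`, `A` be the images of `𝔨`, `𝔭`, `𝔞` in `U(𝔤)`, let `G = 1 + K + P`, and let `J` be
the sum of `I` and the image of `S(𝔞)`. The powers of `G` exhaust `U(𝔤)`, and `G ^ n ≤ J` is proved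
by induction on `n`. Modulo `U(𝔤)𝔨` and lower degree only `P ^ (n + 1)` matters
(`pow_succ_le_of_eq_sup`), and its factors are turned into elements of `A` one at a time.

The replacement rests on weights. Since `θ` is `-1` on `𝔞`, it sends a vector `v` of `𝔞`-weight `λ`
to one of weight `-λ`. Hence `𝔭` is spanned by `𝔞`, which absorbs the zero-weight part because `𝔞`
is its own centralizer in `𝔭`, and by the `x = v - θ v` with `λ ≠ 0`. If `λ(h) = 1`, then `x = [h,
k]` with `k = v + θ v` in `𝔨`, and `𝔞 = ker λ ⊕ ℂ h` with `ker λ` commuting with both `h` and `k`.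

For `b` a product of elements of `ker λ` and `u` a product of elements of `𝔭`, the element `(p + 1)
b h^p x u` agrees in top degree with `b [h^(p+1), k] u = b h^(p+1) k u - k b h^(p+1) u`. The last
term lies in `𝔨U(𝔤)`. In the other, `k` moves right through `u`, leaving a term of `U(𝔤)𝔨` and terms
with one more factor from `A` and one fewer from `P` (`mul_pow_mul_mem`).

Finally `A ^ m ≤ J`: `𝔥` is even, and abelian because it is self-centralizing, so symmetrization on
`S(𝔞)` is plain multiplication. -/

namespace Submodule

/-! ### Degree reduction in a filtered associative algebra -/

variable {U : Type*} [Ring U] [Algebra ℂ U]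

theorem mul_eq_mul_of_commute {M N : Submodule ℂ U} (h : ∀ m ∈ M, ∀ n ∈ N, Commute m n) :
    M * N = N * M := by
  refine le_antisymm (mul_le.2 fun m hm n hn => ?_) (mul_le.2 fun n hn m hm => ?_)
  · rw [(h m hm n hn).eq]; exact mul_mem_mul hn hm
  · rw [← (h m hm n hn).eq]; exact mul_mem_mul hm hn

theorem commute_of_mem_pow {M : Submodule ℂ U} {k : U} (h : ∀ m ∈ M, Commute m k) (n : ℕ) :
    ∀ b ∈ M ^ n, Commute b k := by
  induction n with
  | zero =>
    intro b hb
    rw [pow_zero, mem_one] at hb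
    obtain ⟨c, rfl⟩ := hb
    exact Algebra.commutes c k
  | succ n ih =>
    intro b hb
    rw [pow_succ] at hb
    induction hb using Submodule.mul_induction_on' with
    | mem_mul_mem x hx y hy => exact (ih x hx).mul_left (h y hy)
    | add x _ y _ hx hy => exact hx.add_left hy

/-- Commutators of `K` with `P` stay in `P`, so carrying an element of `K` to the right end never
raises the degree in `P`. -/
theorem mul_pow_le_of_mul_le {K P : Submodule ℂ U} (h : K * P ≤ P * K ⊔ P) (n : ℕ) :
    K * P ^ n ≤ P ^ n * K ⊔ P ^ n := by
  induction n with
  | zero => simp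
  | succ n ih =>
    calc K * P ^ (n + 1) = (K * P ^ n) * P := by rw [pow_succ, mul_assoc]
      _ ≤ (P ^ n * K ⊔ P ^ n) * P := by gcongr
      _ = P ^ n * (K * P) ⊔ P ^ (n + 1) := by rw [sup_mul, mul_assoc, pow_succ]
      _ ≤ P ^ n * (P * K ⊔ P) ⊔ P ^ (n + 1) := by gcongr
      _ = P ^ (n + 1) * K ⊔ P ^ (n + 1) := by
        rw [mul_sup, ← mul_assoc, ← pow_succ, sup_assoc, sup_idem]

/-- Commuting `k` past a power of `h`, up to terms of lower degree. -/
theorem pow_mul_sub_mem {G : Submodule ℂ U} {h k x : U} (hh : h ∈ G)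
    (hk : h * k - k * h = x) (hx : h * x - x * h ∈ G) (p : ℕ) :
    h ^ (p + 1) * k - k * h ^ (p + 1) - ((p : ℂ) + 1) • (h ^ p * x) ∈ G ^ p := by
  induction p with
  | zero => simp [hk]
  | succ p ih =>
    -- The error term obeys `D_{p+1} = D_p h - (p + 1) h^p [h, x]`, and each summand has degree at
    -- most `p + 1`.
    have h1 : h ^ (p + 2) * k - k * h ^ (p + 2) - (((p + 1 : ℕ) : ℂ) + 1) • (h ^ (p + 1) * x) =
        (h ^ (p + 1) * k - k * h ^ (p + 1) - ((p : ℂ) + 1) • (h ^ p * x)) * h -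
          ((p : ℂ) + 1) • (h ^ p * (h * x - x * h)) := by
      rw [Nat.cast_add, Nat.cast_one, add_smul _ (1 : ℂ), one_smul, ← hk]
      simp only [sub_mul, mul_sub, smul_sub, smul_mul_assoc, pow_succ, mul_assoc]
      abel
    rw [h1]
    refine sub_mem ?_ (smul_mem _ _ ?_)
    · rw [pow_succ]; exact mul_mem_mul ih hh
    · rw [pow_succ]; exact mul_mem_mul (pow_mem_pow _ hh p) hx

/-- The core reduction: `h^p x` is traded for `[h^(p+1), k]` up to lower degree. Here `hG` disposes
of the error, and `hAP` is the case with one more factor from `A` and `x` gone. -/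
theorem mul_pow_mul_mem {G K P A J : Submodule ℂ U} {h k x : U} {l p j : ℕ}
    (hKJ : K * ⊤ ≤ J) (hJK : ⊤ * K ≤ J) (hAG : A ≤ G) (hPG : P ≤ G)
    (hKP : K * P ≤ P * K ⊔ P) (hG : G ^ (l + p + j) ≤ J) (hAP : A ^ (l + p + 1) * P ^ j ≤ J)
    (hh : h ∈ A) (hk : k ∈ K) (hhk : h * k - k * h = x) (hx : h * x - x * h ∈ G)
    {b u : U} (hb : b ∈ A ^ l) (hbk : Commute b k) (hu : u ∈ P ^ j) :
    b * h ^ p * x * u ∈ J := by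
  set D := h ^ (p + 1) * k - k * h ^ (p + 1) - ((p : ℂ) + 1) • (h ^ p * x) with hD
  have hDG : D ∈ G ^ p := pow_mul_sub_mem (hAG hh) hhk hx p
  have h1 : b * h ^ (p + 1) * (k * u) ∈ J := by
    have h2 : A ^ (l + p + 1) * (P ^ j * K ⊔ P ^ j) ≤ J := by
      rw [mul_sup, ← mul_assoc]
      exact sup_le ((mul_le_mul' le_top le_rfl).trans hJK) hAP
    refine h2 (mul_mem_mul ?_ (mul_pow_le_of_mul_le hKP j (mul_mem_mul hk hu)))
    rw [add_assoc, pow_add]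
    exact mul_mem_mul hb (pow_mem_pow _ hh _)
  have h3 : k * (b * h ^ (p + 1) * u) ∈ J := hKJ (mul_mem_mul hk trivial)
  have h4 : b * D * u ∈ J := by
    apply hG
    rw [pow_add, pow_add]
    exact mul_mem_mul (mul_mem_mul (pow_le_pow_left' hAG l hb) hDG) (pow_le_pow_left' hPG j hu)
  have h5 : ((p : ℂ) + 1) • (b * h ^ p * x * u) =
      b * h ^ (p + 1) * (k * u) - k * (b * h ^ (p + 1) * u) - b * D * u := by
    -- The only place where `b` must commute with `k`: it lets `k` reach the far left, where `K * ⊤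
    -- ≤ J` applies.
    have : k * (b * h ^ (p + 1) * u) = b * (k * h ^ (p + 1)) * u := by
      rw [← mul_assoc, ← mul_assoc, ← hbk.eq, mul_assoc b]
    rw [this, hD]
    simp only [sub_mul, mul_sub, smul_mul_assoc, mul_smul_comm, mul_assoc]
    abel
  -- Characteristic zero enters here.
  have hp : ((p : ℂ) + 1) ≠ 0 := Nat.cast_add_one_ne_zero p
  rw [← inv_smul_smul₀ hp (b * h ^ p * x * u), h5]
  exact smul_mem _ _ (sub_mem (sub_mem h1 h3) h4)

/-- As `A` is spanned by `B` and `h`, and these commute, `A ^ n` is spanned by sorted products `b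
h^p`, to which `mul_pow_mul_mem` applies. -/
theorem pow_mul_span_mul_pow_le {G K P A B J : Submodule ℂ U} {h k x : U}
    (hKJ : K * ⊤ ≤ J) (hJK : ⊤ * K ≤ J) (hAG : A ≤ G) (hPG : P ≤ G)
    (hKP : K * P ≤ P * K ⊔ P) (hh : h ∈ A) (hk : k ∈ K) (hhk : h * k - k * h = x)
    (hx : h * x - x * h ∈ G) (hBA : B ≤ A) (hA : A ≤ B ⊔ span ℂ {h})
    (hBh : ∀ b ∈ B, Commute b h) (hBk : ∀ b ∈ B, Commute b k) {n j : ℕ}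
    (hG : G ^ (n + j) ≤ J) (hAP : A ^ (n + 1) * P ^ j ≤ J) :
    A ^ n * span ℂ {x} * P ^ j ≤ J := by
  set H := span ℂ {h}
  have hHB : Commute H B := mul_eq_mul_of_commute fun c hc b hb => by
    obtain ⟨c, rfl⟩ := mem_span_singleton.1 hc
    exact ((hBh b hb).symm).smul_left c
  -- Here `l + p` factors are already sorted into `B` and `h`, and `m` factors of `A` remain
  -- unsorted.
  have key : ∀ m l p, l + p + m = n → B ^ l * H ^ p * A ^ m * span ℂ {x} * P ^ j ≤ J := by
    intro m
    induction m with
    | zero =>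
      rintro l p rfl
      rw [pow_zero, mul_one, span_pow, Set.singleton_pow]
      refine mul_le.2 fun v hv u hu => ?_
      rw [mul_assoc, span_mul_span, Set.singleton_mul_singleton] at hv
      refine Submodule.mul_induction_on hv (fun b hb y hy => ?_) (fun y z hy hz => ?_)
      · obtain ⟨c, rfl⟩ := mem_span_singleton.1 hy
        rw [mul_smul_comm, smul_mul_assoc, ← mul_assoc]
        exact smul_mem _ _ (mul_pow_mul_mem (l := l) (p := p) hKJ hJK hAG hPG hKP hG hAP hh hk hhk hx
          (pow_le_pow_left' hBA l hb) (commute_of_mem_pow hBk l b hb) hu)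
      · rw [add_mul]; exact add_mem hy hz
    | succ m ih =>
      intro l p hn
      have h1 : B ^ l * H ^ p * A ^ (m + 1) ≤
          B ^ (l + 1) * H ^ p * A ^ m ⊔ B ^ l * H ^ (p + 1) * A ^ m := by
        calc B ^ l * H ^ p * A ^ (m + 1) = B ^ l * H ^ p * A * A ^ m := by
              rw [pow_succ' A]; simp only [mul_assoc]
          _ ≤ B ^ l * H ^ p * (B ⊔ H) * A ^ m := by gcongr
          _ = B ^ (l + 1) * H ^ p * A ^ m ⊔ B ^ l * H ^ (p + 1) * A ^ m := by
            rw [mul_sup, sup_mul, mul_assoc (B ^ l) _ B, (hHB.pow_left p).eq, pow_succ B,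
              pow_succ H]
            simp only [mul_assoc]
      calc B ^ l * H ^ p * A ^ (m + 1) * span ℂ {x} * P ^ j
          ≤ (B ^ (l + 1) * H ^ p * A ^ m ⊔ B ^ l * H ^ (p + 1) * A ^ m) * span ℂ {x} * P ^ j := by
            gcongr
        _ ≤ J := by
          rw [sup_mul, sup_mul]
          exact sup_le (ih _ _ (by omega)) (ih _ _ (by omega))
  simpa using key n 0 0 (by omega)

/-- Any factor from `K` can be pushed to the right end at the cost of lower-degree terms, so only
pure products from `P` survive in top degree. -/
theorem pow_succ_le_of_eq_sup {G K P : Submodule ℂ U} (hG : G = 1 ⊔ K ⊔ P)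
    (hKG : K * G ≤ G * K ⊔ G) (n : ℕ) : G ^ (n + 1) ≤ P ^ (n + 1) ⊔ G ^ n * K ⊔ G ^ n := by
  have hPG : P ≤ G := hG ▸ le_sup_right
  induction n with
  | zero =>
    rw [zero_add, pow_one, pow_one, pow_zero, one_mul]
    exact hG.le.trans (sup_le (sup_le le_sup_right (le_sup_right.trans le_sup_left))
      (le_sup_left.trans le_sup_left))
  | succ n ih =>
    have h1 : P ^ (n + 1) * G ≤ P ^ (n + 2) ⊔ G ^ (n + 1) * K ⊔ G ^ (n + 1) := by
      have := pow_le_pow_left' hPG (n + 1)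
      conv_lhs => rw [hG]
      rw [mul_sup, mul_sup, mul_one, ← pow_succ]
      refine sup_le (sup_le (this.trans le_sup_right) ?_) (le_sup_left.trans le_sup_left)
      exact (mul_le_mul' this le_rfl).trans (le_sup_right.trans le_sup_left)
    have h2 : G ^ n * K * G ≤ G ^ (n + 1) * K ⊔ G ^ (n + 1) := by
      calc G ^ n * K * G = G ^ n * (K * G) := mul_assoc _ _ _
        _ ≤ G ^ n * (G * K ⊔ G) := by gcongr
        _ = _ := by rw [mul_sup, ← mul_assoc, ← pow_succ]
    calc G ^ (n + 2) = G ^ (n + 1) * G := pow_succ _ _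
      _ ≤ (P ^ (n + 1) ⊔ G ^ n * K ⊔ G ^ n) * G := by gcongr
      _ = P ^ (n + 1) * G ⊔ G ^ n * K * G ⊔ G ^ (n + 1) := by rw [sup_mul, sup_mul, ← pow_succ]
      _ ≤ _ := sup_le (sup_le h1 (h2.trans (sup_le (le_sup_right.trans le_sup_left)
          le_sup_right))) le_sup_right

/-- A filtered algebra generated by `G = 1 + K + P` is contained in `J`, provided that `J` contains
`K U + U K` and all powers of `A ⊆ P`, and that `P` is spanned modulo `A` by elements `[h, k]`
for which `A` is spanned by `h` and elements commuting with `h` and `k`. -/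
theorem pow_le_of_spanning {G K P A J : Submodule ℂ U} (X : Set U)
    (hG : G = 1 ⊔ K ⊔ P) (hKG : K * G ≤ G * K ⊔ G) (hKP : K * P ≤ P * K ⊔ P)
    (hKJ : K * ⊤ ≤ J) (hJK : ⊤ * K ≤ J) (hAP : A ≤ P) (hAJ : ∀ m, A ^ m ≤ J)
    (hP : P ≤ A ⊔ span ℂ X)
    (hX : ∀ x ∈ X, ∃ h ∈ A, ∃ k ∈ K, ∃ B ≤ A, h * k - k * h = x ∧ h * x - x * h ∈ G ∧
      A ≤ B ⊔ span ℂ {h} ∧ (∀ b ∈ B, Commute b h) ∧ (∀ b ∈ B, Commute b k)) (n : ℕ) :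
    G ^ n ≤ J := by
  have hPG : P ≤ G := hG ▸ le_sup_right
  induction n with
  | zero => simpa using hAJ 0
  | succ n ih =>
    -- The total degree stays `n + 1` while the number `j` of factors not yet known to lie in `A`
    -- decreases. The outer hypothesis `ih` absorbs terms of degree `n`.
    have key : ∀ j m, m + j = n + 1 → A ^ m * P ^ j ≤ J := by
      intro j
      induction j with
      | zero => intro m _; simpa using hAJ m
      | succ j ihj =>
        intro m hm
        have h1 : A ^ m * span ℂ X * P ^ j ≤ J := by
          have h3 : span ℂ X = ⨆ x ∈ X, span ℂ {x} := by
            rw [← span_iUnion₂]; simp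
          rw [h3]
          simp only [mul_iSup, iSup_mul, iSup_le_iff]
          intro x hx
          obtain ⟨h, hh, k, hk, B, hBA, hhk, hhx, hA, hBh, hBk⟩ := hX x hx
          refine pow_mul_span_mul_pow_le hKJ hJK (hAP.trans hPG) hPG hKP hh hk hhk hhx hBA hA
            hBh hBk ?_ (ihj _ (by omega))
          rwa [show m + j = n by omega]
        calc A ^ m * P ^ (j + 1) = A ^ m * P * P ^ j := by rw [pow_succ', mul_assoc]
          _ ≤ A ^ m * (A ⊔ span ℂ X) * P ^ j := by gcongr
          _ = A ^ (m + 1) * P ^ j ⊔ A ^ m * span ℂ X * P ^ j := by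
            rw [mul_sup, sup_mul, ← pow_succ]
          _ ≤ J := sup_le (ihj _ (by omega)) h1
    refine (pow_succ_le_of_eq_sup hG hKG n).trans (sup_le (sup_le ?_ ?_) ih)
    · simpa using key (n + 1) 0 (by omega)
    · exact (mul_le_mul' le_top le_rfl).trans hJK

end Submodule

/-! ### Commutation and the degree filtration in the enveloping algebra -/

namespace LieSuperalgebra

open DirectSum

variable {𝔤 : Type*} [AddCommGroup 𝔤] [Module ℂ 𝔤] [LieSuperalgebra 𝔤]

theorem envι_mul_envι {i j : ZMod 2} {x y : 𝔤} (hx : x ∈ grading i) (hy : y ∈ grading j) :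
    envι x * envι y = koszulSign i j • (envι y * envι x) + envι (bracket x y) := by
  simpa [envι] using RingQuot.mkAlgHom_rel ℂ (EnvRel.comm hx hy)

theorem bracket_skew_of_even {h : 𝔤} (hh : h ∈ grading 0) (x : 𝔤) :
    bracket h x = -bracket x h := by
  induction x using DirectSum.Decomposition.inductionOn (grading (𝔤 := 𝔤)) with
  | zero => simp
  | homogeneous m => rw [skew hh m.2]; simp [koszulSign]
  | add m m' hm hm' => rw [map_add, hm, hm']; simp [add_comm]

theorem envι_commutator_of_even {h : 𝔤} (hh : h ∈ grading 0) (x : 𝔤) :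
    envι h * envι x - envι x * envι h = envι (bracket h x) := by
  induction x using DirectSum.Decomposition.inductionOn (grading (𝔤 := 𝔤)) with
  | zero => simp
  | homogeneous m => rw [envι_mul_envι hh m.2]; simp [koszulSign]
  | add m m' hm hm' => rw [map_add, map_add, map_add, ← hm, ← hm', mul_add, add_mul]; abel

theorem commute_envι_of_even {h x : 𝔤} (hh : h ∈ grading 0) (hx : bracket h x = 0) :
    Commute (envι h) (envι x) := by
  rw [commute_iff_eq, ← sub_eq_zero, envι_commutator_of_even hh, hx, map_zero]

/-- Stability under homogeneous projections reduces the claim to homogeneous vectors, where the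
Koszul sign is a mere scalar and is absorbed by the subspace. -/
theorem map_envι_mul_map_envι_le {X Y Z : Submodule ℂ 𝔤}
    (hX : ∀ x ∈ X, ∀ i, (decompose grading x i : 𝔤) ∈ X)
    (hY : ∀ y ∈ Y, ∀ i, (decompose grading y i : 𝔤) ∈ Y)
    (hZ : ∀ x ∈ X, ∀ y ∈ Y, bracket x y ∈ Z) :
    X.map envι * Y.map envι ≤ Y.map envι * X.map envι ⊔ Z.map envι := by
  refine Submodule.mul_le.2 ?_
  rintro _ ⟨x, hx, rfl⟩ _ ⟨y, hy, rfl⟩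
  classical
  rw [← sum_support_decompose grading x, ← sum_support_decompose grading y, map_sum, map_sum,
    Finset.sum_mul_sum]
  refine sum_mem fun i _ => sum_mem fun j _ => ?_
  rw [envι_mul_envι (decompose grading x i).2 (decompose grading y j).2]
  exact Submodule.add_mem_sup
    (Submodule.smul_mem _ _ (Submodule.mul_mem_mul ⟨_, hY y hy j, rfl⟩ ⟨_, hX x hx i, rfl⟩))
    ⟨_, hZ _ (hX x hx i) _ (hY y hy j), rfl⟩

variable (𝔤) in
-- Including `1` in the generating subspace makes its powers increasing, so their supremum is a
-- union.
theorem iSup_one_sup_range_envι_pow :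
    ⨆ n : ℕ, ((1 : Submodule ℂ (Env 𝔤)) ⊔ (⊤ : Submodule ℂ 𝔤).map envι) ^ n = ⊤ := by
  set G := (1 : Submodule ℂ (Env 𝔤)) ⊔ (⊤ : Submodule ℂ 𝔤).map envι
  have hmono : Monotone fun n : ℕ => G ^ n := fun m n h => pow_le_pow_right' le_sup_left h
  rw [← top_le_iff]
  rintro u -
  obtain ⟨t, rfl⟩ := RingQuot.mkAlgHom_surjective ℂ (EnvRel 𝔤) u
  rw [Submodule.mem_iSup_of_directed _ hmono.directed_le]
  induction t using TensorAlgebra.induction with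
  | algebraMap r =>
    exact ⟨0, by rw [AlgHom.commutes, pow_zero]; exact Submodule.algebraMap_mem r⟩
  | ι x =>
    refine ⟨1, ?_⟩
    rw [pow_one]
    exact le_sup_right (a := (1 : Submodule ℂ (Env 𝔤))) ⟨x, trivial, rfl⟩
  | mul a b ha hb =>
    obtain ⟨m, hm⟩ := ha
    obtain ⟨n, hn⟩ := hb
    exact ⟨m + n, by rw [map_mul, pow_add]; exact Submodule.mul_mem_mul hm hn⟩
  | add a b ha hb =>
    obtain ⟨m, hm⟩ := ha
    obtain ⟨n, hn⟩ := hb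
    refine ⟨max m n, ?_⟩
    rw [map_add]
    exact add_mem (hmono (le_max_left m n) hm) (hmono (le_max_right m n) hn)

/-! ### Symmetrization on a commuting even subspace -/

/-- All signs are `1` and all `n!` reordered products coincide, so the average is any one of them.
-/
theorem symmetrize_prod_of_commute (W : Submodule ℂ 𝔤) {n : ℕ} (x : Fin n → W)
    (hx : ∀ i, (x i : 𝔤) ∈ grading 0) (hc : ∀ i j, bracket (x i : 𝔤) (x j : 𝔤) = 0) :
    symmetrize W (List.ofFn fun i => SuperSymAlg.ι (subGrading W) (x i)).prod =
      (List.ofFn fun i => envι (x i : 𝔤)).prod := by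
  have hperm (π : Equiv.Perm (Fin n)) : (List.ofFn fun i => envι (x (π i) : 𝔤)).prod =
      (List.ofFn fun i => envι (x i : 𝔤)).prod := by
    refine List.Perm.prod_eq' (π.ofFn_comp_perm fun i => envι (x i : 𝔤)) ?_
    rw [List.pairwise_ofFn]
    exact fun i j _ => commute_envι_of_even (hx _) (hc _ _)
  have hsign (π : Equiv.Perm (Fin n)) : superSign (fun _ => 0) π = 1 :=
    Finset.prod_eq_one fun _ _ => by simp [koszulSign]
  rw [symmetrize_prod W x (fun _ => 0) hx]
  simp only [hperm, hsign, one_smul, Finset.sum_const, Finset.card_univ, Fintype.card_perm,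
    Fintype.card_fin]
  rw [← Nat.cast_smul_eq_nsmul ℂ, inv_smul_smul₀ (Nat.cast_ne_zero.2 n.factorial_ne_zero)]

theorem map_envι_pow_le_map_symmetrize {V W : Submodule ℂ 𝔤} (h : V ≤ W) (hV : V ≤ grading 0)
    (hc : ∀ x ∈ V, ∀ y ∈ V, bracket x y = 0) (m : ℕ) :
    V.map envι ^ m ≤ (LinearMap.range (symInclusion h).toLinearMap).map (symmetrize W) := by
  rw [← Submodule.span_eq (V.map envι), Submodule.span_pow, Submodule.span_le]
  intro u hu
  obtain ⟨f, rfl⟩ := Set.mem_pow.1 hu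
  choose x hx hxf using fun i => (f i).2
  refine ⟨_, ⟨(List.ofFn fun i => SuperSymAlg.ι (subGrading V) ⟨x i, hx i⟩).prod, rfl⟩, ?_⟩
  have h1 : (symInclusion h).toLinearMap
      (List.ofFn fun i => SuperSymAlg.ι (subGrading V) ⟨x i, hx i⟩).prod =
      (List.ofFn fun i => SuperSymAlg.ι (subGrading W) ⟨x i, h (hx i)⟩).prod := by
    rw [AlgHom.toLinearMap_apply, map_list_prod, List.map_ofFn]
    congr 2
    funext i
    exact SuperSymAlg.map_ι _ _ _
  rw [h1, symmetrize_prod_of_commute W (fun i => ⟨x i, h (hx i)⟩) (fun i => hV (hx i))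
    fun i j => hc _ (hx i) _ (hx j)]
  congr 2
  funext i
  exact hxf i

theorem bracket_eq_zero_of_centralizer_eq {𝔥 : Submodule ℂ 𝔤} (h : centralizer ⊤ 𝔥 = 𝔥) {x y : 𝔤}
    (hx : x ∈ 𝔥) (hy : y ∈ 𝔥) : bracket x y = 0 := by
  rw [← h] at hx
  exact hx.2 y hy

/-! ### The involution and the weights of `𝔞` -/

namespace Involution

variable (θ : Involution 𝔤)

theorem mem_fixedPart {x : 𝔤} : x ∈ θ.fixedPart ↔ θ.toLinearMap x = x := by
  simp [fixedPart]

theorem mem_antiPart {x : 𝔤} : x ∈ θ.antiPart ↔ θ.toLinearMap x = -x := by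
  simp [antiPart]

theorem add_mem_fixedPart (x : 𝔤) : x + θ.toLinearMap x ∈ θ.fixedPart := by
  rw [mem_fixedPart, map_add, θ.involutive, add_comm]

theorem sub_mem_antiPart (x : 𝔤) : x - θ.toLinearMap x ∈ θ.antiPart := by
  rw [mem_antiPart, map_sub, θ.involutive, neg_sub]

theorem fixedPart_sup_antiPart : θ.fixedPart ⊔ θ.antiPart = ⊤ := by
  rw [← top_le_iff]
  rintro x -
  have : x = (2⁻¹ : ℂ) • (x + θ.toLinearMap x) + (2⁻¹ : ℂ) • (x - θ.toLinearMap x) := by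
    module
  rw [this]
  exact Submodule.add_mem_sup (Submodule.smul_mem _ _ (θ.add_mem_fixedPart x))
    (Submodule.smul_mem _ _ (θ.sub_mem_antiPart x))

theorem decompose_toLinearMap (x : 𝔤) (i : ZMod 2) :
    (decompose grading (θ.toLinearMap x) i : 𝔤) = θ.toLinearMap (decompose grading x i) := by
  induction x using DirectSum.Decomposition.inductionOn (grading (𝔤 := 𝔤)) with
  | zero => simp
  | @homogeneous j m =>
    by_cases hij : j = i
    · subst hij
      rw [decompose_of_mem_same _ m.2, decompose_of_mem_same _ (θ.map_mem m.2)]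
    · rw [decompose_of_mem_ne _ m.2 hij, decompose_of_mem_ne _ (θ.map_mem m.2) hij, map_zero]
  | add m m' hm hm' => simp [hm, hm']

theorem decompose_mem_fixedPart (x : 𝔤) (hx : x ∈ θ.fixedPart) (i : ZMod 2) :
    (decompose grading x i : 𝔤) ∈ θ.fixedPart := by
  rw [mem_fixedPart] at hx ⊢
  rw [← decompose_toLinearMap, hx]

theorem decompose_mem_antiPart (x : 𝔤) (hx : x ∈ θ.antiPart) (i : ZMod 2) :
    (decompose grading x i : 𝔤) ∈ θ.antiPart := by
  rw [mem_antiPart] at hx ⊢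
  rw [← decompose_toLinearMap, hx, decompose_neg]
  rfl

theorem bracket_fixedPart_antiPart (x : 𝔤) (hx : x ∈ θ.fixedPart) (y : 𝔤) (hy : y ∈ θ.antiPart) :
    bracket x y ∈ θ.antiPart := by
  rw [mem_fixedPart] at hx
  rw [mem_antiPart] at hy ⊢
  rw [θ.map_bracket, hx, hy, map_neg]

theorem bracket_toLinearMap_of_mem_antiPart {h v : 𝔤} {c : ℂ} (hh : h ∈ θ.antiPart)
    (hv : bracket h v = c • v) :
    bracket h (θ.toLinearMap v) = -(c • θ.toLinearMap v) := by
  rw [mem_antiPart] at hh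
  have := θ.map_bracket h v
  rw [hv, hh, map_smul, map_neg, LinearMap.neg_apply] at this
  rw [this, neg_neg]

theorem bracket_add_of_mem_antiPart {h v : 𝔤} {c : ℂ} (hh : h ∈ θ.antiPart)
    (hv : bracket h v = c • v) :
    bracket h (v + θ.toLinearMap v) = c • (v - θ.toLinearMap v) := by
  rw [map_add, hv, θ.bracket_toLinearMap_of_mem_antiPart hh hv, smul_sub, sub_eq_add_neg]

theorem bracket_sub_of_mem_antiPart {h v : 𝔤} {c : ℂ} (hh : h ∈ θ.antiPart)
    (hv : bracket h v = c • v) :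
    bracket h (v - θ.toLinearMap v) = c • (v + θ.toLinearMap v) := by
  rw [map_sub, hv, θ.bracket_toLinearMap_of_mem_antiPart hh hv, smul_add, sub_neg_eq_add]

/-- The vectors `v - θ v`, where `v` is a weight vector for `𝔟` of nonzero weight. -/
def weightDifferences (𝔟 : Submodule ℂ 𝔤) : Set 𝔤 :=
  {x | ∃ v, (∀ h ∈ 𝔟, ∃ c : ℂ, bracket h v = c • v) ∧ (∃ h ∈ 𝔟, bracket h v ≠ 0) ∧
    x = v - θ.toLinearMap v}

variable {θ} {𝔥 : Submodule ℂ 𝔤}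

/-- The map `id - θ` is twice the identity on `𝔭`, so it suffices to apply it to the spanning weight
vectors. At weight zero on `𝔞`, the vector `v - θ v` centralizes `𝔞`, hence lies in `𝔞`. -/
theorem antiPart_le_splitPart_sup_span (h_even : 𝔥 ≤ grading 0) (h_diag : AdDiagonalizable 𝔥)
    (h_split : centralizer θ.antiPart (θ.splitPart 𝔥) = θ.splitPart 𝔥) :
    θ.antiPart ≤ θ.splitPart 𝔥 ⊔ Submodule.span ℂ (θ.weightDifferences (θ.splitPart 𝔥)) := by
  set N := θ.splitPart 𝔥 ⊔ Submodule.span ℂ (θ.weightDifferences (θ.splitPart 𝔥)) with hN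
  have h1 : ⊤ ≤ N.comap (LinearMap.id - θ.toLinearMap) := by
    rw [← (show _ = ⊤ from h_diag), Submodule.span_le]
    intro v hv
    rw [SetLike.mem_coe, Submodule.mem_comap, LinearMap.sub_apply, LinearMap.id_apply, hN]
    by_cases hz : ∃ h ∈ θ.splitPart 𝔥, bracket h v ≠ 0
    · exact le_sup_right (a := θ.splitPart 𝔥)
        (Submodule.subset_span ⟨v, fun h hh => hv h hh.1, hz, rfl⟩)
    · push Not at hz
      refine le_sup_left (a := θ.splitPart 𝔥) ?_
      rw [← h_split]
      refine ⟨θ.sub_mem_antiPart v, fun h hh => ?_⟩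
      have hv0 : bracket h v = (0 : ℂ) • v := by rw [hz h hh, zero_smul]
      rw [← neg_eq_zero, ← bracket_skew_of_even (h_even hh.1),
        θ.bracket_sub_of_mem_antiPart hh.2 hv0, zero_smul]
  intro x hx
  have h2 : x - θ.toLinearMap x ∈ N := h1 (Submodule.mem_top (x := x))
  rw [θ.mem_antiPart.1 hx] at h2
  have : x = (2⁻¹ : ℂ) • (x - -x) := by module
  rw [this]
  exact Submodule.smul_mem _ _ h2

/-- Supplies the data for the degree reduction: `h` is rescaled so that `λ(h) = 1`, `k = v + θ v`,
and `𝔟` is the kernel of `λ` on `𝔞`. -/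
theorem exists_commutator_of_mem_weightDifferences
    (h_comm : ∀ x ∈ 𝔥, ∀ y ∈ 𝔥, bracket x y = 0) {x : 𝔤}
    (hx : x ∈ θ.weightDifferences (θ.splitPart 𝔥)) :
    ∃ h ∈ θ.splitPart 𝔥, ∃ k ∈ θ.fixedPart, ∃ 𝔟 ≤ θ.splitPart 𝔥, bracket h k = x ∧
      θ.splitPart 𝔥 ≤ 𝔟 ⊔ Submodule.span ℂ {h} ∧ (∀ b ∈ 𝔟, bracket b h = 0) ∧
      ∀ b ∈ 𝔟, bracket b k = 0 := by
  obtain ⟨v, hv, ⟨h₀, hh₀, hne⟩, rfl⟩ := hx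
  obtain ⟨c, hc⟩ := hv h₀ hh₀
  have hc0 : c ≠ 0 := by
    rintro rfl
    exact hne (by rw [hc, zero_smul])
  refine ⟨c⁻¹ • h₀, Submodule.smul_mem _ _ hh₀, _, θ.add_mem_fixedPart v,
    θ.splitPart 𝔥 ⊓ LinearMap.ker (bracket.flip v), inf_le_left, ?_, ?_, ?_, ?_⟩
  · rw [map_smul, LinearMap.smul_apply, θ.bracket_add_of_mem_antiPart hh₀.2 hc,
      inv_smul_smul₀ hc0]
  · intro y hy
    obtain ⟨d, hd⟩ := hv y hy
    -- With `d = λ(y)`, subtracting `d` times the normalized vector leaves an element of `ker λ`.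
    have : y = (y - d • c⁻¹ • h₀) + d • c⁻¹ • h₀ := by abel
    rw [this]
    refine Submodule.add_mem_sup ⟨sub_mem hy ?_, ?_⟩
      (Submodule.smul_mem _ _ (Submodule.mem_span_singleton_self _))
    · exact Submodule.smul_mem _ _ (Submodule.smul_mem _ _ hh₀)
    · rw [SetLike.mem_coe, LinearMap.mem_ker, LinearMap.flip_apply]
      simp only [map_sub, map_smul, LinearMap.sub_apply, LinearMap.smul_apply, hd, hc,
        inv_smul_smul₀ hc0, sub_self]
  · intro b hb
    exact h_comm _ hb.1.1 _ (Submodule.smul_mem _ _ hh₀.1)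
  · intro b hb
    have hb0 : bracket b v = (0 : ℂ) • v := by rw [zero_smul]; exact hb.2
    rw [θ.bracket_add_of_mem_antiPart hb.1.2 hb0, zero_smul]

/-! ### The decomposition of `U(𝔤)` and surjectivity -/

theorem biIdeal_sup_map_symmetrize_eq_top (h_even : 𝔥 ≤ grading 0)
    (h_comm : ∀ x ∈ 𝔥, ∀ y ∈ 𝔥, bracket x y = 0) (h_diag : AdDiagonalizable 𝔥)
    (h_split : centralizer θ.antiPart (θ.splitPart 𝔥) = θ.splitPart 𝔥) :
    θ.biIdeal ⊔ ((LinearMap.range (symInclusion (θ.splitPart_le 𝔥)).toLinearMap).map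
        (symmetrize θ.antiPart)) = ⊤ := by
  set J := θ.biIdeal ⊔ ((LinearMap.range (symInclusion (θ.splitPart_le 𝔥)).toLinearMap).map
        (symmetrize θ.antiPart))
  have htop : (⊤ : Submodule ℂ 𝔤).map envι = θ.fixedPart.map envι ⊔ θ.antiPart.map envι := by
    rw [← Submodule.map_sup, fixedPart_sup_antiPart]
  have hKT : θ.fixedPart.map envι * (⊤ : Submodule ℂ 𝔤).map envι ≤
      (⊤ : Submodule ℂ 𝔤).map envι * θ.fixedPart.map envι ⊔ (⊤ : Submodule ℂ 𝔤).map envι :=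
    map_envι_mul_map_envι_le θ.decompose_mem_fixedPart (fun _ _ _ => trivial)
      fun _ _ _ _ => trivial
  rw [← top_le_iff, ← iSup_one_sup_range_envι_pow, iSup_le_iff]
  refine Submodule.pow_le_of_spanning (K := θ.fixedPart.map envι) (P := θ.antiPart.map envι)
    (A := (θ.splitPart 𝔥).map envι) (envι '' θ.weightDifferences (θ.splitPart 𝔥)) ?_ ?_ ?_ ?_ ?_
    ?_ ?_ ?_ ?_
  · rw [htop, sup_assoc]
  · rw [Submodule.mul_sup, Submodule.sup_mul, mul_one, one_mul]
    refine sup_le (le_sup_left.trans le_sup_left) (hKT.trans ?_)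
    exact sup_le (le_sup_right.trans le_sup_left) (le_sup_right.trans le_sup_right)
  · exact map_envι_mul_map_envι_le θ.decompose_mem_fixedPart θ.decompose_mem_antiPart
      θ.bracket_fixedPart_antiPart
  · exact le_sup_left.trans (le_sup_left (a := θ.biIdeal))
  · exact le_sup_right.trans (le_sup_left (a := θ.biIdeal))
  · exact Submodule.map_mono (θ.splitPart_le 𝔥)
  · exact fun m => (map_envι_pow_le_map_symmetrize _ (inf_le_left.trans h_even)
      (fun x hx y hy => h_comm x hx.1 y hy.1) m).trans le_sup_right
  · rw [← Submodule.map_span, ← Submodule.map_sup]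
    exact Submodule.map_mono (antiPart_le_splitPart_sup_span h_even h_diag h_split)
  · rintro _ ⟨x, hx, rfl⟩
    obtain ⟨h, hh, k, hk, 𝔟, h𝔟, hhk, hsup, hbh, hbk⟩ :=
      exists_commutator_of_mem_weightDifferences h_comm hx
    have hh0 := h_even hh.1
    refine ⟨envι h, ⟨h, hh, rfl⟩, envι k, ⟨k, hk, rfl⟩, 𝔟.map envι, Submodule.map_mono h𝔟,
      ?_, ?_, ?_, ?_, ?_⟩
    · rw [envι_commutator_of_even hh0, hhk]
    · rw [envι_commutator_of_even hh0]
      exact le_sup_right (a := (1 : Submodule ℂ (Env 𝔤))) ⟨_, trivial, rfl⟩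
    · rw [← Set.image_singleton, ← Submodule.map_span, ← Submodule.map_sup]
      exact Submodule.map_mono hsup
    · rintro _ ⟨b, hb, rfl⟩
      exact commute_envι_of_even (h_even (h𝔟 hb).1) (hbh b hb)
    · rintro _ ⟨b, hb, rfl⟩
      exact commute_envι_of_even (h_even (h𝔟 hb).1) (hbk b hb)

end Involution

end LieSuperalgebra

open LieSuperalgebra in
theorem corollary3p8 {𝔤 : Type*} [AddCommGroup 𝔤] [Module ℂ 𝔤] [LieSuperalgebra 𝔤]
    (θ : Involution 𝔤) (𝔥 : Submodule ℂ 𝔤)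
    (h_even : 𝔥 ≤ grading 0)
    (h_subalgebra : ∀ x ∈ 𝔥, ∀ y ∈ 𝔥, bracket x y ∈ 𝔥)
    (h_stable : 𝔥.map θ.toLinearMap = 𝔥)
    (h_diag : AdDiagonalizable 𝔥)
    (h_selfcentral : centralizer ⊤ 𝔥 = 𝔥)
    (h_split : centralizer θ.antiPart (θ.splitPart 𝔥) = θ.splitPart 𝔥) :
    θ.biIdeal + ((LinearMap.range (symInclusion (θ.splitPart_le 𝔥)).toLinearMap).map
        (symmetrize θ.antiPart)) = ⊤ ∧
      Function.Surjective
        (fun x : SymOf (θ.splitPart 𝔥) => θ.quotMap (θ.sBar (symInclusion (θ.splitPart_le 𝔥) x))) := by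
  have key := Involution.biIdeal_sup_map_symmetrize_eq_top h_even
    (fun _ hx _ hy => bracket_eq_zero_of_centralizer_eq h_selfcentral hx hy) h_diag h_split
  refine ⟨key, fun q => ?_⟩
  obtain ⟨u, rfl⟩ := Submodule.mkQ_surjective _ q
  have hu : u ∈ θ.biIdeal ⊔ _ := key.ge (Submodule.mem_top (x := u))
  -- The component in `I` dies in the quotient, so the element `z` of `S(𝔞)` is a preimage.
  obtain ⟨i, hi, _, ⟨_, ⟨z, rfl⟩, rfl⟩, rfl⟩ := Submodule.mem_sup.1 hu
  refine ⟨z, ?_⟩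
  rw [map_add, Submodule.mkQ_apply _ i, (Submodule.Quotient.mk_eq_zero _).2 hi, zero_add]
  rfl
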